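/- **Setting.** Let $I,O$ be finite disjoint sets of Boolean input and output variables. A *separated game structure* $GS$ is given by assertions $\theta_I$ over $I$, $\theta_O$ over $O$ (initial conditions), $\rho_I$ over $I\cup I'$ and $\rho_O$ over $O\cup O'$ (transitions). States are the pairs $s=(i,o)\in 2^I\times 2^O$. From $(i,o)$ the environment chooses $i_1$ with $(i,i_1')\models\rho_I$, then the system, knowing $i_1$, chooses $o_1$ with $(o,o_1')\models\rho_O$; the new state is $(i_1,o_1)$. A player who has no legal move loses; an infinite play is won by the system iff it satisfies the winning condition. Strategies may depend on the whole history. The winning region of the system is the set of states from which it has a winning strategy. A game is *realizable* if the system can answer every initial input $i\models\theta_I$ by some $o\models\theta_O$ and has a strategy that wins from all the resulting initial states. The game graph has the edges $(i,o)\to(i_1,o_1)$ with $(i,i_1')\models\rho_I$ and $(o,o_1')\models\rho_O$; the input graph $G_I$ and the output graph $G_O$ are the graphs of $\rho_I$ on $2^I$ and of $\rho_O$ on $2^O$. SCCs are classes of mutual reachability (by paths of length $\ge 0$). Let $\varphi=\bigwedge_{l=1}^k\bigl(\bigwedge_{j=1}^{n_l}\mathsf{GF}\,a_{l,j}\rightarrow\bigwedge_{j=1}^{m_l}\mathsf{GF}\,g_{l,j}\bigr)$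 with assertions $a_{l,j}$ over $I$ and $g_{l,j}$ over $O$. An SCC $S$ of the game graph, with projections $S_I\subseteq 2^I$ and $S_O\subseteq 2^O$, is *accepting* if for every $l$ either every $g_{l,j}$ holds at some $o\in S_O$, or some $a_{l,j}$ holds at no $i\in S_I$. Let $acc$ be the assertion that holds exactly at the states of accepting SCCs, and let $W$ be the system's winning region in $(GS,\mathsf{GF}\,acc)$. **Strategies.** Order all the guarantees $g_{l,j}$ as $gar_0,\dots,gar_{m-1}$. For each $j$ let $f_{r(j)}$ be a memoryless strategy for the output side (a function of the current state and the next input, possibly with value $\bot$) that, at every state whose output lies on a cycle of $G_O$, returns $\bot$ if the SCC in $G_O$ of that output has no $gar_j$-state, and otherwise moves legally inside this SCC and, when followed, leads to a $gar_j$-state. The strategy $f_{travel}$, with a memory $mem$ that is initially $0$, uses the first of $f_{r(mem)},f_{r(mem+1)},\dots$ (indices modulo $m$, at most $m$ of them) that does not return $\bot$, and sets $mem$ to the index used plus $1$ when the output chosen satisfies the corresponding guarantee; if all of them return $\bot$, it returns some legal output in the same SCC of $G_O$. Given a memoryless strategy $f_B$, the *combined strategy* $f$ plays $f_{travel}$ at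 the states $(i,o)\models acc$ such that $o$ lies on a cycle of $G_O$; at all other states it resets $mem$ to $0$ and plays $f_B$. **Theorem.** For every separated game structure $GS$ and every separated GR($k$) condition $\varphi$: 1. $(GS,\mathsf{GF}\,acc)$ is a weak Büchi game, i.e. every SCC of the game graph consists only of $acc$-states or only of non-$acc$-states. 2. $(GS,\varphi)$ is realizable if and only if $(GS,\mathsf{GF}\,acc)$ is realizable. 3. The system's winning region in $(GS,\varphi)$ is exactly $W$. 4. From every state outside $W$ the environment has a winning strategy in $(GS,\varphi)$. 5. There is a memoryless $f_B$ that wins $(GS,\mathsf{GF}\,acc)$ from every state of $W$; for every ordering of the guarantees, strategies $f_{r(j)}$ and a choice of outputs staying in the SCC, as above, exist; and for every such $f_B$ and every such ordering, $f_{r(j)}$ and choice, the combined strategy $f$ wins $(GS,\varphi)$ from every state of $W$. -/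

import Mathlib

noncomputable section

/-- A valuation of a set `V` of Boolean variables, i.e. an element of `2^V`. -/
abbrev BVal (V : Type*) := V → Bool

/-- A state over disjoint sets of input variables `I` and output variables `O`. -/
abbrev GState (I O : Type*) := BVal I × BVal O

/-- A game structure: the initial assumption is an assertion over `I`, the initial guarantee over
`I ∪ O`, the safety assumption over `I ∪ O ∪ I'`, the safety guarantee over `I ∪ O ∪ I' ∪ O'`. -/
structure GameStructure (I O : Type*) where
  initI : BVal I → Prop
  initO : GState I O → Prop
  rhoI : GState I O → BVal I → Prop
  rhoO : GState I O → GState I O → Prop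

/-- A winning condition: a property of infinite sequences of states. -/
abbrev WinCond (I O : Type*) := (ℕ → GState I O) → Prop

/-- The condition `GF a`: the assertion `a` holds infinitely often. -/
def GF {I O : Type*} (a : GState I O → Prop) : WinCond I O :=
  fun π => ∀ n, ∃ m, n ≤ m ∧ a (π m)

/-- A strategy of the system maps a nonempty history and the next input to the next output.
The history is given by the list of the earlier states, most recent first, and the current
state. -/
abbrev SysStrategy (I O : Type*) :=
  List (GState I O) → GState I O → BVal I → BVal O

/-- A strategy of the environment maps a nonempty history to the next input. -/
abbrev EnvStrategy (I O : Type*) :=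
  List (GState I O) → GState I O → BVal I

/-- The states `π (n-1), …, π 0` visited before time `n`. -/
def past {α : Type*} (π : ℕ → α) : ℕ → List α
  | 0 => []
  | n + 1 => π n :: past π n

/-- The strongly connected component of `a` in the directed graph with edge relation `r`. -/
def scc {α : Type*} (r : α → α → Prop) (a : α) : Set α :=
  {b | Relation.ReflTransGen r a b ∧ Relation.ReflTransGen r b a}

namespace GameStructure

variable {I O : Type*} (G : GameStructure I O)

/-- The edge relation of the game graph. -/
def edge (s t : GState I O) : Prop := G.rhoI s t.1 ∧ G.rhoO s t

/-- The first `n` rounds of `π` result from legal inputs and the outputs chosen by `f`. -/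
def SysConsistent (f : SysStrategy I O) (π : ℕ → GState I O) (n : ℕ) : Prop :=
  ∀ k < n, G.rhoI (π k) (π (k + 1)).1 ∧ (π (k + 1)).2 = f (past π k) (π k) (π (k + 1)).1

/-- The strategy `f` of the system wins from `s`: after every consistent finite play it answers
every legal input legally (if there is no legal input, the environment is stuck and loses), and
every consistent infinite play satisfies the winning condition. -/
def SysWinsWith (W : WinCond I O) (f : SysStrategy I O) (s : GState I O) : Prop :=
  ∀ π : ℕ → GState I O, π 0 = s →
    (∀ n, G.SysConsistent f π n → ∀ i, G.rhoI (π n) i →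
      G.rhoO (π n) (i, f (past π n) (π n) i)) ∧
    ((∀ n, G.SysConsistent f π n) → W π)

/-- The first `n` rounds of `π` result from the inputs chosen by `g` and legal outputs. -/
def EnvConsistent (g : EnvStrategy I O) (π : ℕ → GState I O) (n : ℕ) : Prop :=
  ∀ k < n, (π (k + 1)).1 = g (past π k) (π k) ∧ G.rhoO (π k) (π (k + 1))

/-- The strategy `g` of the environment wins from `s`: after every consistent finite play its
input is legal (if the system then has no legal output, the system is stuck and loses), and every
consistent infinite play violates the winning condition. -/
def EnvWinsWith (W : WinCond I O) (g : EnvStrategy I O) (s : GState I O) : Prop :=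
  ∀ π : ℕ → GState I O, π 0 = s →
    (∀ n, G.EnvConsistent g π n → G.rhoI (π n) (g (past π n) (π n))) ∧
    ((∀ n, G.EnvConsistent g π n) → ¬ W π)

/-- The winning region of the system. -/
def sysRegion (W : WinCond I O) : Set (GState I O) := {s | ∃ f, G.SysWinsWith W f s}

/-- The winning region of the environment. -/
def envRegion (W : WinCond I O) : Set (GState I O) := {s | ∃ g, G.EnvWinsWith W g s}

/-- The game is realizable: the system has an initial response to every initial input and a
strategy that wins from all the resulting initial states. -/
def Realizable (W : WinCond I O) : Prop :=
  ∃ (init : BVal I → BVal O) (f : SysStrategy I O),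
    ∀ i, G.initI i → G.initO (i, init i) ∧ G.SysWinsWith W f (i, init i)

/-- `(G, GF a)` is a weak Büchi game: every SCC of the game graph lies inside `a` or outside. -/
def IsWeakBuchi (a : GState I O → Prop) : Prop :=
  ∀ s, (∀ t ∈ scc G.edge s, a t) ∨ (∀ t ∈ scc G.edge s, ¬ a t)

end GameStructure

/-- A game structure that separates variables: `initO` is an assertion over `O` only, `rhoI` over
`I ∪ I'` only, `rhoO` over `O ∪ O'` only. -/
structure SepGameStructure (I O : Type*) where
  initI : BVal I → Prop
  initO : BVal O → Prop
  rhoI : BVal I → BVal I → Prop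
  rhoO : BVal O → BVal O → Prop

/-- The underlying game structure. -/
def SepGameStructure.toGS {I O : Type*} (G : SepGameStructure I O) : GameStructure I O where
  initI := G.initI
  initO s := G.initO s.2
  rhoI s i := G.rhoI s.1 i
  rhoO s t := G.rhoO s.2 t.2

/-- A GR(`k`) condition that separates variables: for each `l < k`, the assumptions `asm l _` are
assertions over `I` and the guarantees `gar l _` are assertions over `O`. -/
structure SepGR (I O : Type*) (k : ℕ) where
  nAsm : Fin k → ℕ
  nGar : Fin k → ℕ
  asm : (l : Fin k) → Fin (nAsm l) → BVal I → Prop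
  gar : (l : Fin k) → Fin (nGar l) → BVal O → Prop

namespace SepGR

variable {I O : Type*} {k : ℕ} (φ : SepGR I O k)

/-- The winning condition `⋀ l, ((⋀ j, GF (asm l j)) → ⋀ j, GF (gar l j))`. -/
def cond : WinCond I O := fun π =>
  ∀ l, (∀ j, GF (fun s : GState I O => φ.asm l j s.1) π) →
    ∀ j, GF (fun s : GState I O => φ.gar l j s.2) π

/-- The acceptance condition for an SCC `S`, through its projections on inputs and outputs. -/
def Accepting (S : Set (GState I O)) : Prop :=
  ∀ l, (∀ j, ∃ o ∈ Prod.snd '' S, φ.gar l j o) ∨ (∃ j, ∀ i ∈ Prod.fst '' S, ¬ φ.asm l j i)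

/-- The assertion `acc`: the state belongs to an accepting SCC of the game graph. -/
def acc (G : SepGameStructure I O) (s : GState I O) : Prop :=
  φ.Accepting (scc G.toGS.edge s)

end SepGR

/-- The output `o` lies on a cycle of the output graph. -/
def SepGameStructure.OnCycle {I O : Type*} (G : SepGameStructure I O) (o : BVal O) : Prop :=
  Relation.TransGen G.rhoO o o

/-- `fr` is a reachability strategy for the guarantee `g` inside the SCCs of the output graph. The
value `none` stands for the distinguished value `⊥`. At outputs on no cycle of the output graph,
where no move stays in the SCC, nothing is required. -/
structure IsReachStrategy {I O : Type*} (G : SepGameStructure I O) (g : BVal O → Prop)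
    (fr : GState I O → BVal I → Option (BVal O)) : Prop where
  /-- `⊥` is returned where the SCC of the current output has no `g`-state -/
  bot : ∀ s i, G.OnCycle s.2 → (∀ o ∈ scc G.rhoO s.2, ¬ g o) → fr s i = none
  /-- otherwise the strategy moves legally inside the SCC -/
  stay : ∀ s i, G.OnCycle s.2 → (∃ o ∈ scc G.rhoO s.2, g o) →
    ∃ o ∈ scc G.rhoO s.2, G.rhoO s.2 o ∧ fr s i = some o
  /-- and following it for as long as needed leads to a `g`-state -/
  reach : ∀ π : ℕ → GState I O, G.OnCycle (π 0).2 → (∃ o ∈ scc G.rhoO (π 0).2, g o) →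
    (∀ n, G.rhoI (π n).1 (π (n + 1)).1 ∧ fr (π n) (π (n + 1)).1 = some (π (n + 1)).2) →
    ∃ n, g (π n).2

/-- `st` picks a legal output in the SCC of the current output, wherever there is one. -/
def IsStayStrategy {I O : Type*} (G : SepGameStructure I O)
    (st : GState I O → BVal I → BVal O) : Prop :=
  ∀ s i, G.OnCycle s.2 → st s i ∈ scc G.rhoO s.2 ∧ G.rhoO s.2 (st s i)

open Classical in
/-- One call of the SCC-travelling strategy, for the guarantees `gar 0, …, gar (m-1)`, with
reachability strategies `fr j` and memory `mem`. It uses the first of `mem, mem + 1, …` (modulo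
`m`) whose reachability strategy is not `⊥`, and it advances the memory when the chosen output
satisfies the guarantee; if all are `⊥`, it just stays in the SCC of the output. The result is
the output and the new memory. -/
def travelStep {I O : Type*} {m : ℕ} (gar : Fin m → BVal O → Prop)
    (fr : Fin m → GState I O → BVal I → Option (BVal O))
    (st : GState I O → BVal I → BVal O)
    (mem : ℕ) (s : GState I O) (i : BVal I) : BVal O × ℕ :=
  ((List.finRange m).findSome? fun t : Fin m =>
      let j : Fin m := ⟨(mem + t) % m, Nat.mod_lt _ t.pos⟩
      (fr j s i).map fun o => (o, if gar j o then (j : ℕ) + 1 else mem)).getD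
    (st s i, mem)

open Classical in
/-- One call of the combined strategy: travel at accepting states (provided that the SCC of the
current output has an edge, so that one can stay in it), and otherwise reset the memory and follow
the memoryless strategy `fB`. -/
def combinedStep {I O : Type*} {k m : ℕ} (G : SepGameStructure I O) (φ : SepGR I O k)
    (gar : Fin m → BVal O → Prop)
    (fB : GState I O → BVal I → BVal O)
    (fr : Fin m → GState I O → BVal I → Option (BVal O))
    (st : GState I O → BVal I → BVal O)
    (mem : ℕ) (s : GState I O) (i : BVal I) : BVal O × ℕ :=
  if φ.acc G s ∧ G.OnCycle s.2 then travelStep gar fr st mem s i else (fB s i, 0)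

/-- The memory after a history (earlier states most recent first, then the current state). -/
def memAfter {I O M : Type*} (step : M → GState I O → BVal I → BVal O × M) (init : M) :
    List (GState I O) → GState I O → M
  | [], _ => init
  | t :: h, s => (step (memAfter step init h t) t s.1).2

/-- The strategy with memory given by an update function and an initial memory value. -/
def memStrategy {I O M : Type*} (step : M → GState I O → BVal I → BVal O × M)
    (init : M) : SysStrategy I O :=
  fun h s i => (step (memAfter step init h s) s i).1

/-- The memoryless strategy given by a function of the current state and the next input. -/
def memoryless {I O : Type*} (f : GState I O → BVal I → BVal O) : SysStrategy I O :=
  fun _ s i => f s i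

end

/-! Since inputs and outputs move independently, a product walk settles into one SCC of the input
graph and one SCC of the output graph. On cycles these two SCCs alone decide acceptance, because
either component can wait on its cycle while the other moves (`acc_iff`).

The finite Büchi game for `acc` is positionally determined (`exists_isBuchiSolution`); let `Z` be
the system's region. The crux is a delay argument. If one environment move, or one system move
undone, led out of `Z`, the positional winning strategies of the two players could be run against
each other on input and output sequences shifted by one step. Both resulting plays settle in the
same pair of SCCs, so they agree on `GF acc`, yet one is won by each player. Hence `Z` is closed
under advancing the input and rewinding the output (`mem_of_reflTransGen`).

Therefore the system may wander inside its output SCC without leaving `Z`, and the environment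
inside its input SCC without entering `Z`. In `Z`, the combined strategy cannot settle in a
non-accepting pair, as it would then follow `fB` forever; in an accepting pair it visits every
guarantee available. Outside `Z`, the environment tours its SCC at non-accepting states and plays
its Büchi strategy elsewhere. It cannot settle in an accepting pair, and in a non-accepting one it
meets every available assumption while some required guarantee is unavailable. -/

namespace GameStructure

variable {I O : Type*} (G : GameStructure I O)

/-! ### Positional determinacy of finite Büchi games -/

/-- The states from which the system can force the next state into `X`. -/
def cpre (X : Set (GState I O)) : Set (GState I O) :=
  {s | ∀ i, G.rhoI s i → ∃ o, G.rhoO s (i, o) ∧ (i, o) ∈ X}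

/-- The states from which the system can force a visit to `T` within `n` rounds. -/
def attrN (T : Set (GState I O)) : ℕ → Set (GState I O)
  | 0 => T
  | n + 1 => T ∪ G.cpre (attrN T n)

/-- The attractor of `T` for the system. -/
def attr (T : Set (GState I O)) : Set (GState I O) := ⋃ n, G.attrN T n

/-- The states from which the system can force `n` visits to `a`. -/
def buchiN (a : GState I O → Prop) : ℕ → Set (GState I O)
  | 0 => Set.univ
  | n + 1 => G.attr ({s | a s} ∩ G.cpre (buchiN a n))

variable {G}

theorem cpre_mono {X Y : Set (GState I O)} (h : X ⊆ Y) : G.cpre X ⊆ G.cpre Y := by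
  intro s hs i hi
  obtain ⟨o, ho, hX⟩ := hs i hi
  exact ⟨o, ho, h hX⟩

theorem attrN_monotone (T : Set (GState I O)) : Monotone (G.attrN T) := by
  refine monotone_nat_of_le_succ fun n => ?_
  induction n with
  | zero => exact Set.subset_union_left
  | succ n ih => exact Set.union_subset_union_right _ (cpre_mono ih)

theorem attrN_mono {T U : Set (GState I O)} (h : T ⊆ U) (n : ℕ) : G.attrN T n ⊆ G.attrN U n := by
  induction n with
  | zero => exact h
  | succ n ih => exact Set.union_subset_union h (cpre_mono ih)

theorem attr_mono {T U : Set (GState I O)} (h : T ⊆ U) : G.attr T ⊆ G.attr U :=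
  Set.iUnion_mono fun n => attrN_mono h n

theorem subset_attr (T : Set (GState I O)) : T ⊆ G.attr T :=
  Set.subset_iUnion (G.attrN T) 0

/-- There are finitely many inputs, so the numbers of rounds needed after each of them have a common
bound. -/
theorem cpre_attr_subset [Finite I] (T : Set (GState I O)) :
    G.cpre (G.attr T) ⊆ G.attr T := by
  classical
  intro s hs
  have h : ∀ i, ∃ n, G.rhoI s i → ∃ o, G.rhoO s (i, o) ∧ (i, o) ∈ G.attrN T n := by
    intro i
    by_cases hi : G.rhoI s i
    · obtain ⟨o, ho, hX⟩ := hs i hi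
      obtain ⟨n, hn⟩ := Set.mem_iUnion.1 hX
      exact ⟨n, fun _ => ⟨o, ho, hn⟩⟩
    · exact ⟨0, fun h => absurd h hi⟩
  choose n hn using h
  obtain ⟨N, hN⟩ := (Set.finite_range n).bddAbove
  refine Set.mem_iUnion.2 ⟨N + 1, Or.inr fun i hi => ?_⟩
  obtain ⟨o, ho, hX⟩ := hn i hi
  exact ⟨o, ho, attrN_monotone T (hN ⟨i, rfl⟩) hX⟩

theorem buchiN_antitone (a : GState I O → Prop) : Antitone (G.buchiN a) := by
  refine antitone_nat_of_succ_le fun n => ?_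
  induction n with
  | zero => exact Set.subset_univ _
  | succ n ih => exact attr_mono (Set.inter_subset_inter_right _ (cpre_mono ih))

theorem exists_buchiN_stable [Finite I] [Finite O] (a : GState I O → Prop) :
    ∃ K, G.buchiN a (K + 1) = G.buchiN a K := by
  obtain ⟨n, hn⟩ := WellFoundedGT.monotone_chain_condition
    (⟨fun n => OrderDual.toDual (G.buchiN a n), fun _ _ h => buchiN_antitone a h⟩ :
      ℕ →o (Set (GState I O))ᵒᵈ)
  exact ⟨n, (hn (n + 1) n.le_succ).symm⟩

variable (G) in
/-- Positional data for the game with Büchi condition `GF a`: a set `Z` of states, a memoryless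
strategy `f` of the system that stays in `Z` and wins there, and a memoryless strategy `g` of the
environment that stays outside `Z` and wins there. -/
structure IsBuchiSolution (a : GState I O → Prop) (Z : Set (GState I O))
    (f : GState I O → BVal I → BVal O) (g : GState I O → BVal I) : Prop where
  sys_step : ∀ s ∈ Z, ∀ i, G.rhoI s i → G.rhoO s (i, f s i) ∧ (i, f s i) ∈ Z
  sys_win : ∀ π : ℕ → GState I O, (∀ n, π n ∈ Z) →
    (∀ n, G.rhoI (π n) (π (n + 1)).1 ∧ (π (n + 1)).2 = f (π n) (π (n + 1)).1) → GF a π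
  env_step : ∀ s ∉ Z, G.rhoI s (g s) ∧ ∀ o, G.rhoO s (g s, o) → (g s, o) ∉ Z
  env_win : ∀ π : ℕ → GState I O, (∀ n, π n ∉ Z) →
    (∀ n, (π (n + 1)).1 = g (π n) ∧ G.rhoO (π n) (π (n + 1))) → ¬ GF a π

/-- The fixed-point equation gives each state of `Z` an attractor rank. Off `a` the strategy lowers
the rank; at `a`-states it only has to remain in `Z`. A play therefore cannot avoid `a` forever. -/
theorem exists_sys_positional {a : GState I O → Prop} {Z : Set (GState I O)}
    (hZ : Z = G.attr ({s | a s} ∩ G.cpre Z)) :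
    ∃ f : GState I O → BVal I → BVal O,
      (∀ s ∈ Z, ∀ i, G.rhoI s i → G.rhoO s (i, f s i) ∧ (i, f s i) ∈ Z) ∧
      ∀ π : ℕ → GState I O, (∀ n, π n ∈ Z) →
        (∀ n, G.rhoI (π n) (π (n + 1)).1 ∧ (π (n + 1)).2 = f (π n) (π (n + 1)).1) →
        GF a π := by
  classical
  set T : Set (GState I O) := {s | a s} ∩ G.cpre Z with hT
  have hsub : ∀ n, G.attrN T n ⊆ Z := fun n => by
    rw [hZ]; exact Set.subset_iUnion (G.attrN T) n
  let rank : GState I O → ℕ := fun s => sInf {n | s ∈ G.attrN T n}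
  have key : ∀ s i, ∃ o, s ∈ Z → G.rhoI s i →
      G.rhoO s (i, o) ∧ (i, o) ∈ Z ∧ (¬ a s → rank (i, o) < rank s) := by
    intro s i
    by_cases h : s ∈ Z ∧ G.rhoI s i
    · obtain ⟨hs, hi⟩ := h
      have hne : {n | s ∈ G.attrN T n}.Nonempty := by
        rw [hZ] at hs; exact Set.mem_iUnion.1 hs
      have hr : s ∈ G.attrN T (rank s) := Nat.sInf_mem hne
      have fromT : s ∈ T → ∃ o, s ∈ Z → G.rhoI s i →
          G.rhoO s (i, o) ∧ (i, o) ∈ Z ∧ (¬ a s → rank (i, o) < rank s) := fun h => by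
        obtain ⟨o, ho, hoZ⟩ := h.2 i hi
        exact ⟨o, fun _ _ => ⟨ho, hoZ, fun hn => absurd h.1 hn⟩⟩
      rcases hk : rank s with _ | n
      · rw [hk] at hr
        rw [← hk]
        exact fromT hr
      · rw [hk] at hr
        rcases hr with hr | hr
        · rw [← hk]
          exact fromT hr
        · obtain ⟨o, ho, hon⟩ := hr i hi
          exact ⟨o, fun _ _ => ⟨ho, hsub _ hon, fun _ => Nat.lt_succ_of_le (Nat.sInf_le hon)⟩⟩
    · exact ⟨fun _ => false, fun h1 h2 => absurd ⟨h1, h2⟩ h⟩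
  choose f hf using key
  refine ⟨f, fun s hs i hi => ⟨(hf s i hs hi).1, (hf s i hs hi).2.1⟩, fun π hπ hc n => ?_⟩
  induction hk : rank (π n) using Nat.strong_induction_on generalizing n with
  | _ r ih =>
    by_cases ha : a (π n)
    · exact ⟨n, le_rfl, ha⟩
    · have h := (hf (π n) (π (n + 1)).1 (hπ n) (hc n).1).2.2 ha
      rw [← (hc n).2] at h
      obtain ⟨m, hm, ham⟩ := ih _ (hk ▸ h) (n + 1) rfl
      exact ⟨m, by omega, ham⟩

/-- The rank of a state is the least number of visits to `a` that the system cannot force. The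
environment never lets it grow and lowers it strictly at `a`-states, so `a` is met only finitely
often. -/
theorem exists_env_positional [Finite I] (a : GState I O → Prop) (K : ℕ) :
    ∃ g : GState I O → BVal I,
      (∀ s ∉ G.buchiN a K, G.rhoI s (g s) ∧
        ∀ o, G.rhoO s (g s, o) → (g s, o) ∉ G.buchiN a K) ∧
      ∀ π : ℕ → GState I O, (∀ n, π n ∉ G.buchiN a K) →
        (∀ n, (π (n + 1)).1 = g (π n) ∧ G.rhoO (π n) (π (n + 1))) → ¬ GF a π := by
  classical
  let rank : GState I O → ℕ := fun s => sInf {n | s ∉ G.buchiN a n}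
  have key : ∀ s, ∃ i, s ∉ G.buchiN a K → G.rhoI s i ∧ ∀ o, G.rhoO s (i, o) →
      (i, o) ∉ G.buchiN a K ∧ rank (i, o) ≤ rank s ∧ (a s → rank (i, o) < rank s) := by
    intro s
    by_cases hs : s ∉ G.buchiN a K
    · have hr : s ∉ G.buchiN a (rank s) := Nat.sInf_mem (s := {n | s ∉ G.buchiN a n}) ⟨K, hs⟩
      have hrK : rank s ≤ K := Nat.sInf_le hs
      rcases hk : rank s with _ | k
      · rw [hk] at hr
        exact absurd (Set.mem_univ s) hr
      · rw [hk] at hr hrK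
        by_cases ha : a s
        · have h : s ∉ G.cpre (G.buchiN a k) := fun h => hr (subset_attr _ ⟨ha, h⟩)
          simp only [cpre, Set.mem_ofPred_eq, not_forall, not_exists, not_and] at h
          obtain ⟨i, hi, ho⟩ := h
          refine ⟨i, fun _ => ⟨hi, fun o hro => ⟨fun hK => ho o hro
            (buchiN_antitone a (by omega) hK), ?_, fun _ => ?_⟩⟩⟩
          · exact (Nat.sInf_le (ho o hro)).trans k.le_succ
          · exact Nat.lt_succ_of_le (Nat.sInf_le (ho o hro))
        · have h : s ∉ G.cpre (G.buchiN a (k + 1)) := fun h => hr (cpre_attr_subset _ h)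
          simp only [cpre, Set.mem_ofPred_eq, not_forall, not_exists, not_and] at h
          obtain ⟨i, hi, ho⟩ := h
          exact ⟨i, fun _ => ⟨hi, fun o hro => ⟨fun hK => ho o hro
            (buchiN_antitone a hrK hK), Nat.sInf_le (ho o hro), fun h => absurd h ha⟩⟩⟩
    · exact ⟨fun _ => false, fun h => absurd h hs⟩
  choose g hg using key
  refine ⟨g, fun s hs => ⟨(hg s hs).1, fun o ho => ((hg s hs).2 o ho).1⟩, fun π hπ hc hGF => ?_⟩
  have hstep : ∀ n, rank (π (n + 1)) ≤ rank (π n) ∧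
      (a (π n) → rank (π (n + 1)) < rank (π n)) := by
    intro n
    have h := (hg (π n) (hπ n)).2 (π (n + 1)).2
    rw [← (hc n).1] at h
    exact (h (hc n).2).2
  have hanti : Antitone fun n => rank (π n) := antitone_nat_of_succ_le fun n => (hstep n).1
  have main : ∀ r n, rank (π n) = r → False := by
    intro r
    induction r using Nat.strong_induction_on with
    | _ r ih =>
      intro n hn
      obtain ⟨m, hm, ham⟩ := hGF n
      exact ih _ (((hstep m).2 ham).trans_le ((hanti hm).trans hn.le)) (m + 1) rfl
  exact main _ 0 rfl

theorem exists_isBuchiSolution [Finite I] [Finite O] (a : GState I O → Prop) :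
    ∃ Z f g, G.IsBuchiSolution a Z f g := by
  obtain ⟨K, hK⟩ := G.exists_buchiN_stable a
  obtain ⟨f, hf, hfw⟩ := exists_sys_positional (G := G) (a := a) (Z := G.buchiN a K) hK.symm
  obtain ⟨g, hg, hgw⟩ := G.exists_env_positional a K
  exact ⟨_, f, g, hf, hfw, hg, hgw⟩

/-! ### Plays of strategies against each other -/

variable (G) in
/-- The play of `f` against `g` from `s`: the earlier states and the current state. -/
def duel (f : SysStrategy I O) (g : EnvStrategy I O) (s : GState I O) :
    ℕ → List (GState I O) × GState I O
  | 0 => ([], s)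
  | n + 1 =>
    let p := duel f g s n
    (p.2 :: p.1, (g p.1 p.2, f p.1 p.2 (g p.1 p.2)))

theorem not_sysWins_and_envWins {W : WinCond I O} {f : SysStrategy I O} {g : EnvStrategy I O}
    {s : GState I O} (hf : G.SysWinsWith W f s) (hg : G.EnvWinsWith W g s) : False := by
  let π : ℕ → GState I O := fun n => (duel f g s n).2
  have hpast : ∀ n, past π n = (duel f g s n).1 := by
    intro n
    induction n with
    | zero => rfl
    | succ n ih => simp [past, duel, ih, π]
  have h1 : ∀ n, (π (n + 1)).1 = g (past π n) (π n) := fun n => by simp [hpast, π, duel]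
  have h2 : ∀ n, (π (n + 1)).2 = f (past π n) (π n) (π (n + 1)).1 := fun n => by
    simp [hpast, π, duel]
  have main : ∀ n, G.SysConsistent f π n ∧ G.EnvConsistent g π n := by
    intro n
    induction n with
    | zero => exact ⟨fun k hk => absurd hk k.not_lt_zero, fun k hk => absurd hk k.not_lt_zero⟩
    | succ n ih =>
      have hI : G.rhoI (π n) (π (n + 1)).1 := by
        rw [h1]; exact (hg π rfl).1 n ih.2
      have hO : G.rhoO (π n) (π (n + 1)) := by
        have := (hf π rfl).1 n ih.1 _ hI
        rwa [← h2] at this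
      constructor
      · intro k hk
        rcases Nat.lt_succ_iff_lt_or_eq.1 hk with hk | rfl
        · exact ih.1 k hk
        · exact ⟨hI, h2 k⟩
      · intro k hk
        rcases Nat.lt_succ_iff_lt_or_eq.1 hk with hk | rfl
        · exact ih.2 k hk
        · exact ⟨h1 k, hO⟩
  exact (hg π rfl).2 (fun n => (main n).2) ((hf π rfl).2 fun n => (main n).1)

namespace IsBuchiSolution

variable {a : GState I O → Prop} {Z : Set (GState I O)}
  {f : GState I O → BVal I → BVal O} {g : GState I O → BVal I}

theorem sysWinsWith (h : G.IsBuchiSolution a Z f g) {s : GState I O} (hs : s ∈ Z) :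
    G.SysWinsWith (GF a) (memoryless f) s := by
  intro π h0
  have hmem : ∀ n, G.SysConsistent (memoryless f) π n → π n ∈ Z := by
    intro n
    induction n with
    | zero => intro _; rwa [h0]
    | succ n ih =>
      intro hc
      have hn := hc n n.lt_succ_self
      have := (h.sys_step _ (ih fun k hk => hc k (hk.trans n.lt_succ_self)) _ hn.1).2
      rw [show f (π n) (π (n + 1)).1 = (π (n + 1)).2 from hn.2.symm] at this
      exact this
  exact ⟨fun n hc i hi => (h.sys_step _ (hmem n hc) i hi).1, fun hc =>
    h.sys_win π (fun n => hmem n (hc n)) fun n => hc (n + 1) n n.lt_succ_self⟩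

theorem envWinsWith (h : G.IsBuchiSolution a Z f g) {s : GState I O} (hs : s ∉ Z) :
    G.EnvWinsWith (GF a) (fun _ => g) s := by
  intro π h0
  have hmem : ∀ n, G.EnvConsistent (fun _ => g) π n → π n ∉ Z := by
    intro n
    induction n with
    | zero => intro _; rwa [h0]
    | succ n ih =>
      intro hc
      have hn := hc n n.lt_succ_self
      have := (h.env_step _ (ih fun k hk => hc k (hk.trans n.lt_succ_self))).2 (π (n + 1)).2
      rw [show g (π n) = (π (n + 1)).1 from hn.1.symm] at this
      exact this hn.2
  exact ⟨fun n hc => (h.env_step _ (hmem n hc)).1, fun hc =>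
    h.env_win π (fun n => hmem n (hc n)) fun n => hc (n + 1) n n.lt_succ_self⟩

theorem sysRegion_eq (h : G.IsBuchiSolution a Z f g) : G.sysRegion (GF a) = Z := by
  ext s
  refine ⟨fun ⟨f', hf'⟩ => ?_, fun hs => ⟨_, h.sysWinsWith hs⟩⟩
  by_contra hs
  exact not_sysWins_and_envWins hf' (h.envWinsWith hs)

end IsBuchiSolution

/-- After one round a memoryless winning strategy for a Büchi condition is still winning. -/
theorem SysWinsWith.memoryless_step {a : GState I O → Prop} {f : GState I O → BVal I → BVal O}
    {s : GState I O} (h : G.SysWinsWith (GF a) (memoryless f) s) {i : BVal I} (hi : G.rhoI s i) :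
    G.rhoO s (i, f s i) ∧ G.SysWinsWith (GF a) (memoryless f) (i, f s i) := by
  refine ⟨(h (fun _ => s) rfl).1 0 (fun k hk => absurd hk k.not_lt_zero) i hi, fun π h0 => ?_⟩
  -- Prepending `s` gives a play from `s`; the longer history does not affect a memoryless strategy.
  let σ : ℕ → GState I O := fun n => Nat.casesOn n s π
  have hσ : ∀ n, G.SysConsistent (memoryless f) π n → G.SysConsistent (memoryless f) σ (n + 1) := by
    intro n hc k hk
    rcases k with _ | k
    · refine ⟨?_, ?_⟩
      · change G.rhoI s (π 0).1
        rw [h0]; exact hi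
      · change (π 0).2 = f s (π 0).1
        rw [h0]
    · exact hc k (by omega)
  refine ⟨fun n hc j hj => (h σ rfl).1 (n + 1) (hσ n hc) j hj, fun hc n => ?_⟩
  obtain ⟨m, hm, ham⟩ := (h σ rfl).2 (fun n => by
    rcases n with _ | n
    · exact fun k hk => absurd hk k.not_lt_zero
    · exact hσ n (hc n)) (n + 1)
  rcases m with _ | m
  · omega
  · exact ⟨m, by omega, ham⟩

end GameStructure

/-! ### Walks and SCCs in graphs and product graphs -/

section Walks

variable {α β : Type*} {r : α → α → Prop}

/-- There is a walk of length `n` from `a` to `b`. -/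
def Steps (r : α → α → Prop) : ℕ → α → α → Prop
  | 0, a, b => a = b
  | n + 1, a, b => ∃ c, r a c ∧ Steps r n c b

theorem Steps.trans {n k : ℕ} {a b c : α} (h : Steps r n a b) (h' : Steps r k b c) :
    Steps r (n + k) a c := by
  induction n generalizing a with
  | zero => cases h; simpa using h'
  | succ n ih =>
    obtain ⟨d, hd, hn⟩ := h
    rw [Nat.succ_add]
    exact ⟨d, hd, ih hn⟩

theorem Steps.split {n k : ℕ} {a c : α} (h : Steps r (n + k) a c) :
    ∃ b, Steps r n a b ∧ Steps r k b c := by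
  induction n generalizing a with
  | zero => exact ⟨a, rfl, by simpa using h⟩
  | succ n ih =>
    rw [Nat.succ_add] at h
    obtain ⟨d, hd, hn⟩ := h
    obtain ⟨b, hb, hk⟩ := ih hn
    exact ⟨b, ⟨d, hd, hb⟩, hk⟩

theorem Steps.iterate {n : ℕ} {a : α} (h : Steps r n a a) (k : ℕ) : Steps r (n * k) a a := by
  induction k with
  | zero => exact rfl
  | succ k ih => rw [Nat.mul_succ]; exact ih.trans h

theorem Steps.reflTransGen {n : ℕ} {a b : α} (h : Steps r n a b) : Relation.ReflTransGen r a b := by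
  induction n generalizing a with
  | zero => cases h; exact .refl
  | succ n ih =>
    obtain ⟨c, hc, hn⟩ := h
    exact .head hc (ih hn)

theorem Relation.ReflTransGen.exists_steps {a b : α} (h : Relation.ReflTransGen r a b) :
    ∃ n, Steps r n a b := by
  induction h using Relation.ReflTransGen.head_induction_on with
  | refl => exact ⟨0, rfl⟩
  | head hc _ ih =>
    obtain ⟨n, hn⟩ := ih
    exact ⟨n + 1, _, hc, hn⟩

theorem Relation.TransGen.exists_steps {a b : α} (h : Relation.TransGen r a b) :
    ∃ n, Steps r (n + 1) a b := by
  obtain ⟨c, hc, hb⟩ := Relation.TransGen.head'_iff.1 h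
  obtain ⟨n, hn⟩ := hb.exists_steps
  exact ⟨n, c, hc, hn⟩

theorem Steps.prod {q : β → β → Prop} {n : ℕ} {a b : α} {c d : β} (h : Steps r n a b)
    (h' : Steps q n c d) : Steps (fun s t : α × β => r s.1 t.1 ∧ q s.2 t.2) n (a, c) (b, d) := by
  induction n generalizing a c with
  | zero => cases h; cases h'; exact rfl
  | succ n ih =>
    obtain ⟨x, hx, hn⟩ := h
    obtain ⟨y, hy, hn'⟩ := h'
    exact ⟨(x, y), ⟨hx, hy⟩, ih hn hn'⟩

/-- If `a` and `b` are mutually reachable and `c` lies on a cycle, then in the product graph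
`(a, c)` and some `(b, d)` are mutually reachable. -/
theorem exists_mem_scc_prod {q : β → β → Prop} {a b : α} {c : β} (hb : b ∈ scc r a)
    (hc : Relation.TransGen q c c) :
    ∃ d, (b, d) ∈ scc (fun s t : α × β => r s.1 t.1 ∧ q s.2 t.2) (a, c) := by
  obtain ⟨n, hn⟩ := hb.1.exists_steps
  obtain ⟨k, hk⟩ := hb.2.exists_steps
  obtain ⟨p, hp⟩ := hc.exists_steps
  -- The closed walk through `b` has length `n + k`, the cycle at `c` has length `p + 1`. Repeating
  -- each as often as the other is long equalizes the lengths.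
  have hlen : n + (k + (n + k) * p) = (p + 1) * (n + k) := by ring
  have hcyc : Steps q (n + (k + (n + k) * p)) c c := hlen ▸ hp.iterate (n + k)
  obtain ⟨d, hd, hd'⟩ := hcyc.split
  exact ⟨d, (hn.prod hd).reflTransGen,
    ((hk.trans ((hn.trans hk).iterate p)).prod hd').reflTransGen⟩

theorem self_mem_scc (a : α) : a ∈ scc r a := ⟨.refl, .refl⟩

theorem scc_eq_of_mem {a b : α} (h : b ∈ scc r a) : scc r b = scc r a := by
  ext c
  exact ⟨fun hc => ⟨h.1.trans hc.1, hc.2.trans h.2⟩, fun hc => ⟨h.2.trans hc.1, hc.2.trans h.1⟩⟩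

theorem transGen_self_of_mem_scc {a b : α} (ha : Relation.TransGen r a a) (h : b ∈ scc r a) :
    Relation.TransGen r b b :=
  (ha.trans_right h.2).trans_left h.1

/-- An infinite walk in a finite graph eventually stays in one SCC, on cycles. -/
theorem exists_eventually_scc [Finite α] (x : ℕ → α) (hx : ∀ n, r (x n) (x (n + 1))) :
    ∃ N, ∀ n, N ≤ n → x n ∈ scc r (x N) ∧ Relation.TransGen r (x n) (x n) := by
  have hle : ∀ n k, Relation.ReflTransGen r (x n) (x (n + k)) := by
    intro n k
    induction k with
    | zero => exact .refl
    | succ k ih => exact ih.tail (hx _)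
  have hle' : ∀ n m, n ≤ m → Relation.ReflTransGen r (x n) (x m) := fun n m h => by
    obtain ⟨k, rfl⟩ := Nat.exists_eq_add_of_le h
    exact hle n k
  obtain ⟨y, hy⟩ := Finite.exists_infinite_fiber x
  have hinf : (x ⁻¹' {y}).Infinite := Set.infinite_coe_iff.1 hy
  obtain ⟨N, hN⟩ := hinf.nonempty
  refine ⟨N, fun n hn => ?_⟩
  obtain ⟨m, hm, hnm⟩ := hinf.exists_gt n
  have hmN : x m = x N := (show x m = y from hm).trans (show x N = y from hN).symm
  have hback := hle' (n + 1) m hnm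
  rw [hmN] at hback
  exact ⟨⟨hle' N n hn, .head (hx n) hback⟩, Relation.TransGen.head'_iff.2
    ⟨_, hx n, hback.trans (hle' N n hn)⟩⟩

/-- A positional way of reaching a `p`-vertex within the SCCs: there is a rank `d` and a successor
function `next` that stays in the SCC and lowers the rank until a `p`-vertex is met. -/
theorem exists_next_toward (r : α → α → Prop) (p : α → Prop) :
    ∃ (next : α → α) (d : α → ℕ), ∀ a, Relation.TransGen r a a → (∃ b ∈ scc r a, p b) →
      next a ∈ scc r a ∧ r a (next a) ∧ (¬ p a → d (next a) < d a) := by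
  classical
  let d : α → ℕ := fun a => sInf {n | ∃ b ∈ scc r a, p b ∧ Steps r n a b}
  have key : ∀ a, ∃ c, Relation.TransGen r a a → (∃ b ∈ scc r a, p b) →
      c ∈ scc r a ∧ r a c ∧ (¬ p a → d c < d a) := by
    intro a
    by_cases h : Relation.TransGen r a a ∧ ∃ b ∈ scc r a, p b
    · obtain ⟨ha, b, hb, hpb⟩ := h
      by_cases hpa : p a
      · obtain ⟨c, hc, hca⟩ := Relation.TransGen.head'_iff.1 ha
        exact ⟨c, fun _ _ => ⟨⟨.single hc, hca⟩, hc, fun h => absurd hpa h⟩⟩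
      · obtain ⟨k, hk⟩ := hb.1.exists_steps
        have hmem : ∃ b ∈ scc r a, p b ∧ Steps r (d a) a b :=
          Nat.sInf_mem (s := {n | ∃ b ∈ scc r a, p b ∧ Steps r n a b}) ⟨k, b, hb, hpb, hk⟩
        obtain ⟨e, he, hpe, hs⟩ := hmem
        rcases hd : d a with _ | n
        · rw [hd] at hs
          cases hs
          exact absurd hpe hpa
        · rw [hd] at hs
          obtain ⟨c, hc, hn⟩ := hs
          have hca : c ∈ scc r a := ⟨.single hc, hn.reflTransGen.trans he.2⟩
          refine ⟨c, fun _ _ => ⟨hca, hc, fun _ => Nat.lt_succ_of_le (Nat.sInf_le ?_)⟩⟩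
          exact ⟨e, by rw [scc_eq_of_mem hca]; exact he, hpe, hn⟩
    · exact ⟨a, fun h1 h2 => absurd ⟨h1, h2⟩ h⟩
  choose next hnext using key
  exact ⟨next, d, hnext⟩

end Walks

/-! ### Acceptance in terms of the component SCCs -/

section Acc

variable {I O : Type*} {k : ℕ} {G : SepGameStructure I O} {φ : SepGR I O k}

/-- Walks project to the input graph; conversely, an input walk lifts by letting the output run
around its cycle. -/
theorem fst_image_scc_edge {i : BVal I} {o : BVal O} (ho : Relation.TransGen G.rhoO o o) :
    Prod.fst '' scc G.toGS.edge (i, o) = scc G.rhoI i := by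
  ext i'
  constructor
  · rintro ⟨t, ht, rfl⟩
    exact ⟨Relation.ReflTransGen.lift (r := G.toGS.edge) Prod.fst (fun _ _ h => h.1) _ _ ht.1,
      Relation.ReflTransGen.lift (r := G.toGS.edge) Prod.fst (fun _ _ h => h.1) _ _ ht.2⟩
  · intro h
    obtain ⟨o', h'⟩ := exists_mem_scc_prod h ho
    exact ⟨_, h', rfl⟩

theorem snd_image_scc_edge {i : BVal I} {o : BVal O} (hi : Relation.TransGen G.rhoI i i) :
    Prod.snd '' scc G.toGS.edge (i, o) = scc G.rhoO o := by
  ext o'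
  constructor
  · rintro ⟨t, ht, rfl⟩
    exact ⟨Relation.ReflTransGen.lift (r := G.toGS.edge) Prod.snd (fun _ _ h => h.2) _ _ ht.1,
      Relation.ReflTransGen.lift (r := G.toGS.edge) Prod.snd (fun _ _ h => h.2) _ _ ht.2⟩
  · intro h
    obtain ⟨i', h1, h2⟩ := exists_mem_scc_prod h hi
    exact ⟨(i', o'), ⟨Relation.ReflTransGen.lift Prod.swap (fun _ _ h => ⟨h.2, h.1⟩) _ _ h1,
      Relation.ReflTransGen.lift Prod.swap (fun _ _ h => ⟨h.2, h.1⟩) _ _ h2⟩, rfl⟩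

/-- Where both components lie on cycles, acceptance depends on the SCCs of the components only. -/
theorem acc_iff {s : GState I O} (hi : Relation.TransGen G.rhoI s.1 s.1)
    (ho : Relation.TransGen G.rhoO s.2 s.2) :
    φ.acc G s ↔ ∀ l, (∀ j, ∃ o ∈ scc G.rhoO s.2, φ.gar l j o) ∨
      (∃ j, ∀ i ∈ scc G.rhoI s.1, ¬ φ.asm l j i) := by
  have h1 := fst_image_scc_edge (i := s.1) ho
  have h2 := snd_image_scc_edge (o := s.2) hi
  simp only [Prod.mk.eta] at h1 h2
  rw [SepGR.acc, SepGR.Accepting, h1, h2]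

theorem isWeakBuchi_acc (G : SepGameStructure I O) (φ : SepGR I O k) :
    G.toGS.IsWeakBuchi (φ.acc G) := by
  intro s
  have h : ∀ t ∈ scc G.toGS.edge s, (φ.acc G t ↔ φ.acc G s) := fun t ht => by
    rw [SepGR.acc, SepGR.acc, scc_eq_of_mem ht]
  by_cases hs : φ.acc G s
  · exact Or.inl fun t ht => (h t ht).2 hs
  · exact Or.inr fun t ht hacc => hs ((h t ht).1 hacc)

/-- Two infinite walks in the input graph and the output graph end in SCCs of these graphs, and
these determine acceptance. -/
theorem exists_eventually_scc_pair [Finite I] [Finite O] (G : SepGameStructure I O)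
    (φ : SepGR I O k) {x : ℕ → BVal I} {y : ℕ → BVal O}
    (hx : ∀ n, G.rhoI (x n) (x (n + 1))) (hy : ∀ n, G.rhoO (y n) (y (n + 1))) :
    ∃ N, (∀ n, N ≤ n → x n ∈ scc G.rhoI (x N) ∧ Relation.TransGen G.rhoI (x n) (x n)) ∧
      (∀ n, N ≤ n → y n ∈ scc G.rhoO (y N) ∧ Relation.TransGen G.rhoO (y n) (y n)) ∧
      ∀ n m, N ≤ n → N ≤ m → (φ.acc G (x n, y m) ↔ φ.acc G (x N, y N)) := by
  obtain ⟨N₁, h₁⟩ := exists_eventually_scc x hx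
  obtain ⟨N₂, h₂⟩ := exists_eventually_scc y hy
  let N := max N₁ N₂
  have hX : ∀ n, N ≤ n → x n ∈ scc G.rhoI (x N) ∧ Relation.TransGen G.rhoI (x n) (x n) :=
    fun n hn => by
      have h := h₁ n (le_trans (le_max_left _ _) hn)
      rw [scc_eq_of_mem (h₁ N (le_max_left _ _)).1]
      exact h
  have hY : ∀ n, N ≤ n → y n ∈ scc G.rhoO (y N) ∧ Relation.TransGen G.rhoO (y n) (y n) :=
    fun n hn => by
      have h := h₂ n (le_trans (le_max_right _ _) hn)
      rw [scc_eq_of_mem (h₂ N (le_max_right _ _)).1]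
      exact h
  refine ⟨N, hX, hY, fun n m hn hm => ?_⟩
  rw [acc_iff (s := (x n, y m)) (hX n hn).2 (hY m hm).2,
    acc_iff (s := (x N, y N)) (hX N le_rfl).2 (hY N le_rfl).2]
  simp only [scc_eq_of_mem (hX n hn).1, scc_eq_of_mem (hY m hm).1]

end Acc

/-! ### The delay argument -/

section Delay

variable {I O : Type*} {k : ℕ} {G : SepGameStructure I O} {φ : SepGR I O k}
  {Z : Set (GState I O)} {f : GState I O → BVal I → BVal O} {g : GState I O → BVal I}

open GameStructure in
/-- The winning region of the system is closed under moves of the environment alone. -/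
theorem GameStructure.IsBuchiSolution.mem_of_rhoI [Finite I] [Finite O]
    (h : G.toGS.IsBuchiSolution (φ.acc G) Z f g) {i i' : BVal I} {o : BVal O}
    (hs : (i, o) ∈ Z) (hi : G.rhoI i i') : (i', o) ∈ Z := by
  by_contra hs'
  -- The triple is `(x n, x (n + 1), y n)`. The environment plays `g` on the sequence one input
  -- ahead, and the system plays `f` on the undelayed one, so each has what it needs to move.
  let p : ℕ → BVal I × BVal I × BVal O := fun n => Nat.rec (i, i', o)
    (fun _ q => (q.2.1, g (q.2.1, q.2.2), f (q.1, q.2.2) q.2.1)) n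
  let x : ℕ → BVal I := fun n => (p n).1
  let y : ℕ → BVal O := fun n => (p n).2.2
  have hp : ∀ n, (p n).2.1 = x (n + 1) := fun n => rfl
  have hx : ∀ n, x (n + 2) = g (x (n + 1), y n) := fun n => rfl
  have hy : ∀ n, y (n + 1) = f (x n, y n) (x (n + 1)) := fun n => rfl
  have main : ∀ n, (x n, y n) ∈ Z ∧ (x (n + 1), y n) ∉ Z ∧ G.rhoI (x n) (x (n + 1)) := by
    intro n
    induction n with
    | zero => exact ⟨hs, hs', hi⟩
    | succ n ih =>
      obtain ⟨h1, h2, h3⟩ := ih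
      have hS := h.sys_step _ h1 _ h3
      have hE := h.env_step _ h2
      rw [← hy] at hS
      rw [← hx] at hE
      exact ⟨hS.2, hE.2 _ hS.1, hE.1⟩
  have hyO : ∀ n, G.rhoO (y n) (y (n + 1)) := fun n => by
    have := (h.sys_step _ (main n).1 _ (main n).2.2).1
    rwa [← hy] at this
  obtain ⟨N, -, -, hN⟩ := exists_eventually_scc_pair G φ (fun n => (main n).2.2) hyO
  have hS := h.sys_win (fun n => (x n, y n)) (fun n => (main n).1) fun n => ⟨(main n).2.2, hy n⟩
  -- The delayed and undelayed plays share their limit SCCs, so the `acc`-visits won by `f` also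
  -- occur in the play won by `g`.
  refine h.env_win (fun n => (x (n + 1), y n)) (fun n => (main n).2.1)
    (fun n => ⟨hx n, hyO n⟩) fun n => ?_
  obtain ⟨m, hm, ham⟩ := hS (max N n)
  have hNm : N ≤ m := (le_max_left _ _).trans hm
  exact ⟨m, (le_max_right _ _).trans hm,
    (hN (m + 1) m (by omega) hNm).2 ((hN m m hNm hNm).1 ham)⟩

open GameStructure in
/-- The winning region of the system is closed under undoing moves of the system alone. -/
theorem GameStructure.IsBuchiSolution.mem_of_rhoO [Finite I] [Finite O]
    (h : G.toGS.IsBuchiSolution (φ.acc G) Z f g) {i : BVal I} {o o' : BVal O}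
    (hs : (i, o) ∈ Z) (ho : G.rhoO o' o) : (i, o') ∈ Z := by
  by_contra hs'
  -- Here the triple is `(x n, y n, y (n + 1))`: the system's play is one output ahead of the
  -- environment's.
  let p : ℕ → BVal I × BVal O × BVal O := fun n => Nat.rec (i, o', o)
    (fun _ q => (g (q.1, q.2.1), q.2.2, f (q.1, q.2.2) (g (q.1, q.2.1)))) n
  let x : ℕ → BVal I := fun n => (p n).1
  let y : ℕ → BVal O := fun n => (p n).2.1
  have hx : ∀ n, x (n + 1) = g (x n, y n) := fun n => rfl
  have hy : ∀ n, y (n + 2) = f (x n, y (n + 1)) (x (n + 1)) := fun n => rfl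
  have main : ∀ n, (x n, y (n + 1)) ∈ Z ∧ (x n, y n) ∉ Z ∧ G.rhoO (y n) (y (n + 1)) := by
    intro n
    induction n with
    | zero => exact ⟨hs, hs', ho⟩
    | succ n ih =>
      obtain ⟨h1, h2, h3⟩ := ih
      have hE := h.env_step _ h2
      rw [← hx] at hE
      have hS := h.sys_step _ h1 _ hE.1
      rw [← hy] at hS
      exact ⟨hS.2, hE.2 _ h3, hS.1⟩
  have hxI : ∀ n, G.rhoI (x n) (x (n + 1)) := fun n => by
    have := (h.env_step _ (main n).2.1).1
    rwa [← hx] at this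
  obtain ⟨N, -, -, hN⟩ := exists_eventually_scc_pair G φ hxI (fun n => (main n).2.2)
  have hS := h.sys_win (fun n => (x n, y (n + 1))) (fun n => (main n).1) fun n => ⟨hxI n, hy n⟩
  refine h.env_win (fun n => (x n, y n)) (fun n => (main n).2.1)
    (fun n => ⟨hx n, (main n).2.2⟩) fun n => ?_
  obtain ⟨m, hm, ham⟩ := hS (max N n)
  have hNm : N ≤ m := (le_max_left _ _).trans hm
  exact ⟨m, (le_max_right _ _).trans hm,
    (hN m m hNm hNm).2 ((hN m (m + 1) hNm (by omega)).1 ham)⟩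

/-- This makes moves inside an SCC safe: for the system the new output can reach the old one, and
contrapositively for an environment whose new input can reach the old one. -/
theorem GameStructure.IsBuchiSolution.mem_of_reflTransGen [Finite I] [Finite O]
    (h : G.toGS.IsBuchiSolution (φ.acc G) Z f g) {s t : GState I O} (hs : s ∈ Z)
    (hi : Relation.ReflTransGen G.rhoI s.1 t.1) (ho : Relation.ReflTransGen G.rhoO t.2 s.2) :
    t ∈ Z := by
  obtain ⟨i, o⟩ := s
  obtain ⟨i', o'⟩ := t
  change Relation.ReflTransGen G.rhoI i i' at hi
  change Relation.ReflTransGen G.rhoO o' o at ho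
  have h1 : (i', o) ∈ Z := by
    induction hi with
    | refl => exact hs
    | tail _ hr ih => exact h.mem_of_rhoI ih hr
  induction ho using Relation.ReflTransGen.head_induction_on with
  | refl => exact h1
  | head hr _ ih => exact h.mem_of_rhoO ih hr

end Delay

/-! ### The SCC-travelling strategy -/

section Travel

theorem List.findSome?_finRange {β : Type*} {m : ℕ} {f : Fin m → Option β} {t : Fin m} {b : β}
    (ht : f t = some b) (hlt : ∀ t' < t, f t' = none) :
    (List.finRange m).findSome? f = some b := by
  induction m with
  | zero => exact t.elim0
  | succ m ih =>
    rw [List.finRange_succ, List.findSome?_cons]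
    rcases Fin.eq_zero_or_eq_succ t with rfl | ⟨u, rfl⟩
    · rw [ht]
    · rw [hlt 0 (Fin.succ_pos u), List.findSome?_map]
      exact ih (f := f ∘ Fin.succ) ht fun t' h => hlt _ (Fin.succ_lt_succ_iff.2 h)

variable {I O : Type*} {G : SepGameStructure I O} {m : ℕ} {gar : Fin m → BVal O → Prop}
  {fr : Fin m → GState I O → BVal I → Option (BVal O)} {st : GState I O → BVal I → BVal O}

theorem travelStep_of_some {mem : ℕ} {s : GState I O} {i : BVal I} {o : BVal O} {t : Fin m}
    (ht : fr ⟨(mem + t) % m, Nat.mod_lt _ t.pos⟩ s i = some o)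
    (hlt : ∀ t' : Fin m, t' < t → fr ⟨(mem + t') % m, Nat.mod_lt _ t'.pos⟩ s i = none) :
    (travelStep gar fr st mem s i).1 = o ∧
    (gar ⟨(mem + t) % m, Nat.mod_lt _ t.pos⟩ o →
      (travelStep gar fr st mem s i).2 = (mem + t) % m + 1) ∧
    (¬ gar ⟨(mem + t) % m, Nat.mod_lt _ t.pos⟩ o → (travelStep gar fr st mem s i).2 = mem) := by
  classical
  rw [travelStep, List.findSome?_finRange (t := t) (by dsimp only; rw [ht]; rfl)
    (fun t' h => by dsimp only; rw [hlt t' h]; rfl)]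
  refine ⟨rfl, fun h => ?_, fun h => ?_⟩
  · simp [h]
  · simp [h]

theorem travelStep_of_none {mem : ℕ} {s : GState I O} {i : BVal I}
    (h : ∀ j, fr j s i = none) : travelStep gar fr st mem s i = (st s i, mem) := by
  classical
  rw [travelStep, List.findSome?_eq_none_iff.2 fun t _ => by dsimp only; rw [h]; rfl]
  rfl

/-- The travelling strategy uses the first guarantee, from `mem` on, that has a state in the
SCC of the current output. -/
theorem travelStep_of_first (hfr : ∀ j, IsReachStrategy G (gar j) (fr j)) {mem : ℕ}
    {s : GState I O} (hs : G.OnCycle s.2) (i : BVal I) {t : Fin m}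
    (ht : ∃ o ∈ scc G.rhoO s.2, gar ⟨(mem + t) % m, Nat.mod_lt _ t.pos⟩ o)
    (hlt : ∀ t' : Fin m, t' < t →
      ¬ ∃ o ∈ scc G.rhoO s.2, gar ⟨(mem + t') % m, Nat.mod_lt _ t'.pos⟩ o) :
    ∃ o ∈ scc G.rhoO s.2, G.rhoO s.2 o ∧
      fr ⟨(mem + t) % m, Nat.mod_lt _ t.pos⟩ s i = some o ∧
      (travelStep gar fr st mem s i).1 = o ∧
      (gar ⟨(mem + t) % m, Nat.mod_lt _ t.pos⟩ o →
        (travelStep gar fr st mem s i).2 = (mem + t) % m + 1) ∧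
      (¬ gar ⟨(mem + t) % m, Nat.mod_lt _ t.pos⟩ o →
        (travelStep gar fr st mem s i).2 = mem) := by
  obtain ⟨o, ho, hr, he⟩ := (hfr _).stay s i hs ht
  exact ⟨o, ho, hr, he, travelStep_of_some he fun t' h =>
    (hfr _).bot s i hs fun o ho hg => hlt t' h ⟨o, ho, hg⟩⟩

theorem exists_first_guarantee {p : Fin m → Prop} {j : Fin m} (hj : p j) (mem : ℕ) :
    ∃ t : Fin m, p ⟨(mem + t) % m, Nat.mod_lt _ t.pos⟩ ∧
      ∀ t' : Fin m, t' < t → ¬ p ⟨(mem + t') % m, Nat.mod_lt _ t'.pos⟩ := by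
  have hm : 0 < m := j.pos
  have hex : ∃ t : Fin m, p ⟨(mem + t) % m, Nat.mod_lt _ t.pos⟩ := by
    have hr := Nat.mod_lt mem hm
    -- The offset is the cyclic distance from `mem` to `j`; adding `m` avoids truncated subtraction.
    have h0 : (mem + ((j : ℕ) + (m - mem % m)) % m) % m = j := by
      rw [Nat.add_mod_mod, ← Nat.mod_add_mod,
        show mem % m + ((j : ℕ) + (m - mem % m)) = j + m by omega, Nat.add_mod_right,
        Nat.mod_eq_of_lt j.2]
    refine ⟨⟨((j : ℕ) + (m - mem % m)) % m, Nat.mod_lt _ hm⟩, ?_⟩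
    simp only [h0]
    exact hj
  obtain ⟨t, ht, hmin⟩ := WellFounded.has_min (wellFounded_lt (α := Fin m))
    {t | p ⟨(mem + t) % m, Nat.mod_lt _ t.pos⟩} hex
  exact ⟨t, ht, fun t' h hp => hmin t' hp h⟩

theorem travelStep_stays (hfr : ∀ j, IsReachStrategy G (gar j) (fr j)) (hst : IsStayStrategy G st)
    (mem : ℕ) {s : GState I O} (hs : G.OnCycle s.2) (i : BVal I) :
    (travelStep gar fr st mem s i).1 ∈ scc G.rhoO s.2 ∧
      G.rhoO s.2 (travelStep gar fr st mem s i).1 := by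
  by_cases h : ∃ j, ∃ o ∈ scc G.rhoO s.2, gar j o
  · obtain ⟨j, hj⟩ := h
    obtain ⟨t, ht, hlt⟩ := exists_first_guarantee (p := fun j => ∃ o ∈ scc G.rhoO s.2, gar j o)
      hj mem
    obtain ⟨o, ho, hr, -, he, -⟩ := travelStep_of_first (st := st) hfr hs i ht hlt
    rw [he]
    exact ⟨ho, hr⟩
  · push Not at h
    rw [travelStep_of_none fun j => (hfr j).bot s i hs (h j)]
    exact hst s i hs

/-- The travelling strategy visits all guarantees with states in the SCC again and again. -/
theorem travel_visits (hfr : ∀ j, IsReachStrategy G (gar j) (fr j)) {π : ℕ → GState I O}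
    {μ : ℕ → ℕ} (hI : ∀ n, G.rhoI (π n).1 (π (n + 1)).1) (hcyc : ∀ n, G.OnCycle (π n).2)
    (hscc : ∀ n, (π n).2 ∈ scc G.rhoO (π 0).2)
    (hstep : ∀ n, travelStep gar fr st (μ n) (π n) (π (n + 1)).1 = ((π (n + 1)).2, μ (n + 1)))
    {j : Fin m} (hj : ∃ o ∈ scc G.rhoO (π 0).2, gar j o) (n : ℕ) :
    ∃ n', n ≤ n' ∧ gar j (π n').2 := by
  have hS : ∀ n, scc G.rhoO (π n).2 = scc G.rhoO (π 0).2 := fun n => scc_eq_of_mem (hscc n)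
  -- While the memory is unchanged, the same reachability strategy stays in use, so its guarantee is
  -- eventually met and the memory moves past it.
  have round : ∀ (n : ℕ) (t : Fin m),
      (∃ o ∈ scc G.rhoO (π 0).2, gar ⟨(μ n + t) % m, Nat.mod_lt _ t.pos⟩ o) →
      (∀ t' : Fin m, t' < t →
        ¬ ∃ o ∈ scc G.rhoO (π 0).2, gar ⟨(μ n + t') % m, Nat.mod_lt _ t'.pos⟩ o) →
      ∃ n', n ≤ n' ∧ gar ⟨(μ n + t) % m, Nat.mod_lt _ t.pos⟩ (π n').2 ∧
        μ n' = (μ n + t) % m + 1 := by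
    intro n t ht hlt
    by_contra! hno
    have stepAt : ∀ k, μ (n + k) = μ n →
        fr ⟨(μ n + t) % m, Nat.mod_lt _ t.pos⟩ (π (n + k)) (π (n + k + 1)).1
          = some (π (n + k + 1)).2 ∧
        (gar ⟨(μ n + t) % m, Nat.mod_lt _ t.pos⟩ (π (n + k + 1)).2 →
          μ (n + k + 1) = (μ n + t) % m + 1) ∧
        (¬ gar ⟨(μ n + t) % m, Nat.mod_lt _ t.pos⟩ (π (n + k + 1)).2 →
          μ (n + k + 1) = μ n) := by
      intro k hk
      have hs := hstep (n + k)
      rw [hk] at hs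
      obtain ⟨o, -, -, h1, h2, h3⟩ := travelStep_of_first (st := st) hfr (mem := μ n)
        (hcyc (n + k)) (π (n + k + 1)).1 (t := t) (by rw [hS]; exact ht) (by rw [hS]; exact hlt)
      rw [hs] at h2 h3
      subst h2
      exact ⟨h1, h3⟩
    have hconst : ∀ k, μ (n + k) = μ n := by
      intro k
      induction k with
      | zero => rfl
      | succ k ih =>
        obtain ⟨-, h1, h2⟩ := stepAt k ih
        by_cases hg : gar ⟨(μ n + t) % m, Nat.mod_lt _ t.pos⟩ (π (n + k + 1)).2
        · exact absurd (h1 hg) (hno (n + k + 1) (by omega) hg)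
        · exact h2 hg
    -- The shift by one excludes a hit at time `n` itself: only an output chosen from time `n` on
    -- advances the memory.
    obtain ⟨k, hk⟩ := (hfr _).reach (fun k => π (n + 1 + k)) (hcyc _)
      (by rw [hS]; exact ht) fun k => ⟨hI _, by
        have h := (stepAt (1 + k) (hconst _)).1
        rw [← Nat.add_assoc] at h
        exact h⟩
    have hk' : gar ⟨(μ n + t) % m, Nat.mod_lt _ t.pos⟩ (π (n + k + 1)).2 := by
      rw [Nat.add_right_comm]; exact hk
    exact hno (n + k + 1) (by omega) hk' ((stepAt k (hconst k)).2.1 hk')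
  -- Induction on the cyclic distance `d` from the memory to `j`. A round at offset `t < d` leaves
  -- distance `d - t - 1`, `t = d` serves `j`, and `t > d` would have skipped the available
  -- guarantee `j`.
  have main : ∀ d n, (μ n + d) % m = j → ∃ n', n ≤ n' ∧ gar j (π n').2 := by
    intro d
    induction d using Nat.strong_induction_on with
    | _ d ih =>
      intro n hd
      obtain ⟨t, ht, hlt⟩ := exists_first_guarantee
        (p := fun j => ∃ o ∈ scc G.rhoO (π 0).2, gar j o) hj (μ n)
      obtain ⟨n', hn, hg, hμ⟩ := round n t ht hlt
      rcases lt_trichotomy (t : ℕ) d with h | h | h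
      · obtain ⟨n'', hn', hg'⟩ := ih (d - t - 1) (by omega) n' (by
          rw [hμ, Nat.add_assoc, Nat.mod_add_mod, ← hd]
          congr 1
          omega)
        exact ⟨n'', hn.trans hn', hg'⟩
      · have hjt : (⟨(μ n + t) % m, Nat.mod_lt _ t.pos⟩ : Fin m) = j := Fin.ext (by rw [h]; exact hd)
        exact ⟨n', hn, hjt ▸ hg⟩
      · have hdm : d < m := h.trans t.2
        refine absurd ?_ (hlt ⟨d, hdm⟩ h)
        have hjt : (⟨(μ n + d) % m, Nat.mod_lt _ t.pos⟩ : Fin m) = j := Fin.ext hd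
        simp only [hjt]
        exact hj
  obtain ⟨t, ht, -⟩ := exists_first_guarantee (p := fun j' => j' = j) rfl (μ n)
  exact main t n (congrArg Fin.val ht)

theorem exists_isReachStrategy (G : SepGameStructure I O) (p : BVal O → Prop) :
    ∃ fr, IsReachStrategy G p fr := by
  classical
  obtain ⟨next, d, hn⟩ := exists_next_toward G.rhoO p
  refine ⟨fun s _ => if ∃ o ∈ scc G.rhoO s.2, p o then some (next s.2) else none,
    fun s i _ h => if_neg fun ⟨o, ho, hp⟩ => h o ho hp,
    fun s i hs h => ⟨next s.2, (hn _ hs h).1, (hn _ hs h).2.1, if_pos h⟩, fun π h0 hex hc => ?_⟩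
  induction hk : d (π 0).2 using Nat.strong_induction_on generalizing π with
  | _ r ih =>
    by_cases hp : p (π 0).2
    · exact ⟨0, hp⟩
    · have h := (hc 0).2
      rw [if_pos hex] at h
      have h1 : next (π 0).2 = (π 1).2 := Option.some.inj h
      obtain ⟨hmem, -, hlt⟩ := hn _ h0 hex
      rw [h1] at hmem hlt
      obtain ⟨n, hpn⟩ := ih _ (hk ▸ hlt hp) (fun n => π (n + 1))
        (transGen_self_of_mem_scc h0 hmem) (by rw [scc_eq_of_mem hmem]; exact hex)
        (fun n => hc (n + 1)) rfl
      exact ⟨n + 1, hpn⟩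

theorem exists_isStayStrategy (G : SepGameStructure I O) :
    ∃ st : GState I O → BVal I → BVal O, IsStayStrategy G st := by
  obtain ⟨next, d, hn⟩ := exists_next_toward G.rhoO fun _ => True
  exact ⟨fun s _ => next s.2, fun s _ hs =>
    have h := hn s.2 hs ⟨s.2, self_mem_scc _, trivial⟩
    ⟨h.1, h.2.1⟩⟩

end Travel

/-! ### The combined strategy wins inside the region -/

section Combined

variable {I O : Type*} [Finite I] [Finite O] {k m : ℕ} {G : SepGameStructure I O}
  {φ : SepGR I O k} {Z : Set (GState I O)} {f : GState I O → BVal I → BVal O}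
  {g : GState I O → BVal I} {fB : GState I O → BVal I → BVal O}
  {gar : Fin m → BVal O → Prop} {fr : Fin m → GState I O → BVal I → Option (BVal O)}
  {st : GState I O → BVal I → BVal O}

theorem combinedStep_mem (h : G.toGS.IsBuchiSolution (φ.acc G) Z f g)
    (hfB : ∀ s ∈ Z, G.toGS.SysWinsWith (GF (φ.acc G)) (memoryless fB) s)
    (hfr : ∀ j, IsReachStrategy G (gar j) (fr j)) (hst : IsStayStrategy G st)
    (mem : ℕ) {s : GState I O} (hs : s ∈ Z) {i : BVal I} (hi : G.rhoI s.1 i) :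
    G.rhoO s.2 (combinedStep G φ gar fB fr st mem s i).1 ∧
      (i, (combinedStep G φ gar fB fr st mem s i).1) ∈ Z := by
  unfold combinedStep
  split_ifs with hc
  · obtain ⟨h1, h2⟩ := travelStep_stays hfr hst mem hc.2 i
    exact ⟨h2, h.mem_of_reflTransGen hs (.single hi) h1.2⟩
  · obtain ⟨h1, h2⟩ := (hfB s hs).memoryless_step (i := i) hi
    refine ⟨h1, ?_⟩
    rw [← h.sysRegion_eq]
    exact ⟨_, h2⟩

theorem combined_sysWinsWith (h : G.toGS.IsBuchiSolution (φ.acc G) Z f g)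
    (hfB : ∀ s ∈ Z, G.toGS.SysWinsWith (GF (φ.acc G)) (memoryless fB) s)
    (hgar : ∀ l j, ∃ t, gar t = φ.gar l j)
    (hfr : ∀ j, IsReachStrategy G (gar j) (fr j)) (hst : IsStayStrategy G st)
    {s : GState I O} (hs : s ∈ Z) :
    G.toGS.SysWinsWith φ.cond (memStrategy (combinedStep G φ gar fB fr st) 0) s := by
  intro π h0
  set F := memStrategy (combinedStep G φ gar fB fr st) 0
  have hmem : ∀ n, G.toGS.SysConsistent F π n → π n ∈ Z := by
    intro n
    induction n with
    | zero => intro _; rwa [h0]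
    | succ n ih =>
      intro hc
      have hn := hc n n.lt_succ_self
      have := (combinedStep_mem h hfB hfr hst (memAfter (combinedStep G φ gar fB fr st) 0
        (past π n) (π n)) (ih fun k hk => hc k (hk.trans n.lt_succ_self)) hn.1).2
      rw [show (combinedStep G φ gar fB fr st (memAfter (combinedStep G φ gar fB fr st) 0
        (past π n) (π n)) (π n) (π (n + 1)).1).1 = (π (n + 1)).2 from hn.2.symm] at this
      exact this
  refine ⟨fun n hc i hi => (combinedStep_mem h hfB hfr hst _ (hmem n hc) hi).1, fun hc => ?_⟩
  have hZ : ∀ n, π n ∈ Z := fun n => hmem n (hc n)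
  have hI : ∀ n, G.rhoI (π n).1 (π (n + 1)).1 := fun n => (hc (n + 1) n n.lt_succ_self).1
  let μ : ℕ → ℕ := fun n => memAfter (combinedStep G φ gar fB fr st) 0 (past π n) (π n)
  have hstep : ∀ n, combinedStep G φ gar fB fr st (μ n) (π n) (π (n + 1)).1 =
      ((π (n + 1)).2, μ (n + 1)) := fun n =>
    Prod.ext (hc (n + 1) n n.lt_succ_self).2.symm rfl
  have hO : ∀ n, G.rhoO (π n).2 (π (n + 1)).2 := fun n => by
    have := (combinedStep_mem h hfB hfr hst (μ n) (hZ n) (hI n)).1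
    rwa [hstep] at this
  obtain ⟨N, hX, hY, hacc⟩ := exists_eventually_scc_pair G φ hI hO
  have hacc' : ∀ n, N ≤ n → (φ.acc G (π n) ↔ φ.acc G (π N)) := fun n hn => hacc n n hn hn
  -- In a non-accepting limit the tail is a play of the memoryless `fB` from a state of `Z`, so it
  -- would have to visit `acc`.
  have haccN : φ.acc G (π N) := by
    by_contra hno
    obtain ⟨n, -, hn⟩ := (hfB (π N) (hZ N) (fun n => π (N + n)) rfl).2 (fun n k _ => ⟨hI _, by
      have h1 := hstep (N + k)
      rw [combinedStep, if_neg fun h => hno ((hacc' _ (by omega)).1 h.1)] at h1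
      exact (congrArg Prod.fst h1).symm⟩) 0
    exact hno ((hacc' _ (by omega)).1 hn)
  have htravel : ∀ n, travelStep gar fr st (μ (N + n)) (π (N + n)) (π (N + (n + 1))).1 =
      ((π (N + (n + 1))).2, μ (N + (n + 1))) := fun n => by
    have h1 := hstep (N + n)
    rw [combinedStep, if_pos ⟨(hacc' _ (by omega)).2 haccN, (hY _ (by omega)).2⟩] at h1
    exact h1
  intro l hasm j n
  rcases (acc_iff (hX N le_rfl).2 (hY N le_rfl).2).1 haccN l with hall | ⟨j', hj'⟩
  · obtain ⟨t, ht⟩ := hgar l j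
    obtain ⟨n', hn, hg⟩ := travel_visits hfr (π := fun n => π (N + n)) (μ := fun n => μ (N + n))
      (fun n => hI _) (fun n => (hY _ (by omega)).2) (fun n => (hY _ (by omega)).1) htravel
      (j := t) (by rw [ht]; exact hall j) n
    exact ⟨N + n', by omega, ht ▸ hg⟩
  · obtain ⟨n', hn, ha⟩ := hasm j' N
    exact absurd ha (hj' _ (hX n' hn).1)

end Combined

/-! ### The environment wins outside the region -/

section Environment

variable {I O : Type*} {k : ℕ} {G : SepGameStructure I O} {φ : SepGR I O k}

open Classical in
/-- The number of targets among `e 0, e 1, …` dealt with in a history: the current target is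
left when it is met, or when it is outside of the SCC of the current input. -/
noncomputable def targetCount (r : BVal I → BVal I → Prop) (e : ℕ → BVal I) : List (GState I O) → ℕ
  | [] => 0
  | s :: h =>
    if s.1 = e (targetCount r e h) ∨ e (targetCount r e h) ∉ scc r s.1 then
      targetCount r e h + 1
    else targetCount r e h

open Classical in
/-- At non-accepting states whose input lies on a cycle, move to the current target with `next`
(or to the current input, if the target is outside of the SCC); otherwise play `g`. -/
noncomputable def touringStrategy (G : SepGameStructure I O) (φ : SepGR I O k) (e : ℕ → BVal I)
    (next : BVal I → BVal I → BVal I) (g : GState I O → BVal I) : EnvStrategy I O :=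
  fun h s =>
    if ¬ φ.acc G s ∧ Relation.TransGen G.rhoI s.1 s.1 then
      if e (targetCount G.rhoI e h) ∈ scc G.rhoI s.1 then next (e (targetCount G.rhoI e h)) s.1
      else next s.1 s.1
    else g s

theorem exists_recurrent_enumeration (α : Type*) [Countable α] [Nonempty α] :
    ∃ e : ℕ → α, ∀ a n, ∃ k, n ≤ k ∧ e k = a := by
  obtain ⟨e, he⟩ := exists_surjective_nat α
  refine ⟨fun n => e n.unpair.1, fun a n => ?_⟩
  obtain ⟨b, hb⟩ := he a
  exact ⟨Nat.pair b n, Nat.right_le_pair b n, by simp [hb]⟩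

/-- A walk inside an SCC that always moves towards the current target meets every vertex of
the SCC again and again. -/
theorem tour_visits {α : Type*} {r : α → α → Prop} {e : ℕ → α}
    (he : ∀ a n, ∃ k, n ≤ k ∧ e k = a) {d : α → α → ℕ} {x : ℕ → α} {μ : ℕ → ℕ}
    (hscc : ∀ n, scc r (x n) = scc r (x 0))
    (hinc : ∀ n, (x n = e (μ n) ∨ e (μ n) ∉ scc r (x n)) → μ (n + 1) = μ n + 1)
    (hkeep : ∀ n, ¬ (x n = e (μ n) ∨ e (μ n) ∉ scc r (x n)) →
      μ (n + 1) = μ n ∧ d (e (μ n)) (x (n + 1)) < d (e (μ n)) (x n))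
    {a : α} (ha : a ∈ scc r (x 0)) (n : ℕ) : ∃ n', n ≤ n' ∧ x n' = a := by
  -- The distance to a fixed target decreases until the target is met or found to be outside the
  -- SCC.
  have leave : ∀ n, ∃ n', n ≤ n' ∧ μ n' = μ n ∧ (x n' = e (μ n) ∨ e (μ n) ∉ scc r (x n')) := by
    intro n
    induction hk : d (e (μ n)) (x n) using Nat.strong_induction_on generalizing n with
    | _ c ih =>
      by_cases h : x n = e (μ n) ∨ e (μ n) ∉ scc r (x n)
      · exact ⟨n, le_rfl, rfl, h⟩
      · obtain ⟨h1, h2⟩ := hkeep n h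
        rw [← h1] at h2
        obtain ⟨n', hn, h3, h4⟩ := ih _ (by rw [← hk, ← h1]; exact h2) (n + 1) rfl
        rw [h1] at h3 h4
        exact ⟨n', by omega, h3, h4⟩
  have all : ∀ j, ∃ n', n ≤ n' ∧ μ n' = μ n + j := by
    intro j
    induction j with
    | zero => exact ⟨n, le_rfl, rfl⟩
    | succ j ih =>
      obtain ⟨n', hn, hμ⟩ := ih
      obtain ⟨n'', hn', hμ', h⟩ := leave n'
      refine ⟨n'' + 1, by omega, ?_⟩
      rw [hinc n'' (by rw [hμ']; exact h)]
      omega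
  -- Since `a` recurs in the enumeration, it becomes the target again after time `n`; lying in the
  -- SCC, it can only be left by being met.
  obtain ⟨c, hc, hec⟩ := he a (μ n)
  obtain ⟨j, rfl⟩ := Nat.exists_eq_add_of_le hc
  obtain ⟨n', hn, hμ⟩ := all j
  obtain ⟨n'', hn', -, h⟩ := leave n'
  rw [hμ, hec] at h
  refine ⟨n'', hn.trans hn', h.resolve_right fun hno => hno ?_⟩
  rwa [hscc]

theorem exists_envWinsWith_cond [Finite I] [Finite O] {Z : Set (GState I O)}
    {f : GState I O → BVal I → BVal O} {g : GState I O → BVal I}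
    (h : G.toGS.IsBuchiSolution (φ.acc G) Z f g) {s : GState I O} (hs : s ∉ Z) :
    ∃ γ, G.toGS.EnvWinsWith φ.cond γ s := by
  classical
  obtain ⟨e, he⟩ := exists_recurrent_enumeration (BVal I)
  choose next d hnext using fun b : BVal I => exists_next_toward G.rhoI (· = b)
  have hnext' : ∀ a b, Relation.TransGen G.rhoI a a → b ∈ scc G.rhoI a →
      next b a ∈ scc G.rhoI a ∧ G.rhoI a (next b a) ∧ (a ≠ b → d b (next b a) < d b a) :=
    fun a b ha hb => hnext b a ha ⟨b, hb, rfl⟩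
  set γ := touringStrategy G φ e next g with hγ
  have hlegal : ∀ (hist : List (GState I O)) (t : GState I O), t ∉ Z →
      G.rhoI t.1 (γ hist t) ∧ ∀ o, G.rhoO t.2 o → (γ hist t, o) ∉ Z := by
    intro hist t ht
    -- From a successor in `Z`, returning the input within its SCC and undoing the output move would
    -- put `t` in `Z`.
    have closed : ∀ i, i ∈ scc G.rhoI t.1 → ∀ o, G.rhoO t.2 o → (i, o) ∉ Z := fun i hi o ho hZ =>
      ht (h.mem_of_reflTransGen hZ hi.2 (.single ho))
    rw [hγ, touringStrategy]
    split_ifs with h1 h2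
    · obtain ⟨h3, h4, -⟩ := hnext' _ _ h1.2 h2
      exact ⟨h4, closed _ h3⟩
    · obtain ⟨h3, h4, -⟩ := hnext' _ _ h1.2 (self_mem_scc t.1)
      exact ⟨h4, closed _ h3⟩
    · exact h.env_step t ht
  refine ⟨γ, fun π h0 => ?_⟩
  have hmem : ∀ n, G.toGS.EnvConsistent γ π n → π n ∉ Z := by
    intro n
    induction n with
    | zero => intro _; rwa [h0]
    | succ n ih =>
      intro hc
      have hn := hc n n.lt_succ_self
      have := (hlegal (past π n) _ (ih fun k hk => hc k (hk.trans n.lt_succ_self))).2 _ hn.2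
      rw [← hn.1] at this
      exact this
  refine ⟨fun n hc => (hlegal _ _ (hmem n hc)).1, fun hc hφ => ?_⟩
  have hZ : ∀ n, π n ∉ Z := fun n => hmem n (hc n)
  have hin : ∀ n, (π (n + 1)).1 = γ (past π n) (π n) := fun n => (hc (n + 1) n n.lt_succ_self).1
  have hO : ∀ n, G.rhoO (π n).2 (π (n + 1)).2 := fun n => (hc (n + 1) n n.lt_succ_self).2
  have hI : ∀ n, G.rhoI (π n).1 (π (n + 1)).1 := fun n => by
    rw [hin]; exact (hlegal _ _ (hZ n)).1
  obtain ⟨N, hX, hY, hacc⟩ := exists_eventually_scc_pair G φ hI hO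
  have hacc' : ∀ n, N ≤ n → (φ.acc G (π n) ↔ φ.acc G (π N)) := fun n hn => hacc n n hn hn
  have haccN : ¬ φ.acc G (π N) := by
    intro hyes
    refine h.env_win (fun n => π (N + n)) (fun n => hZ _) (fun n => ⟨?_, hO _⟩)
      fun n => ⟨n, le_rfl, (hacc' _ (by omega)).2 hyes⟩
    have h1 := hin (N + n)
    rw [hγ, touringStrategy, if_neg fun h => h.1 ((hacc' _ (by omega)).2 hyes)] at h1
    exact h1
  have htour : ∀ b ∈ scc G.rhoI (π N).1, ∀ n, ∃ n', n ≤ n' ∧ (π (N + n')).1 = b := by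
    intro b hb
    refine tour_visits (r := G.rhoI) he (d := d) (x := fun n => (π (N + n)).1)
      (μ := fun n => targetCount G.rhoI e (past π (N + n)))
      (fun n => scc_eq_of_mem (hX _ (by omega)).1) (fun n h1 => if_pos h1)
      (fun n h1 => ⟨if_neg h1, ?_⟩) hb
    have h2 := hin (N + n)
    rw [not_or, not_not] at h1
    rw [hγ, touringStrategy, if_pos ⟨fun h => haccN ((hacc' _ (by omega)).1 h),
      (hX _ (by omega)).2⟩, if_pos h1.2] at h2
    change d _ (π (N + n + 1)).1 < _
    rw [h2]
    exact (hnext' _ _ (hX _ (by omega)).2 h1.2).2.2 h1.1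
  -- If the play satisfied the condition, the tour would force every guarantee of each `l` whose
  -- assumptions all occur in the input SCC, making the limit accepting.
  refine haccN ((acc_iff (hX N le_rfl).2 (hY N le_rfl).2).2 fun l => ?_)
  by_cases hasm : ∃ j, ∀ i ∈ scc G.rhoI (π N).1, ¬ φ.asm l j i
  · exact Or.inr hasm
  · push Not at hasm
    refine Or.inl fun j => ?_
    obtain ⟨n, hn, hg⟩ := hφ l (fun j' n => by
      obtain ⟨i, hi, ha⟩ := hasm j'
      obtain ⟨n', hn, rfl⟩ := htour i hi n
      exact ⟨N + n', by omega, ha⟩) j N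
    exact ⟨_, (hY n hn).1, hg⟩

end Environment

/-! ### Assembly of the theorem -/

theorem mainTheorem4 {I O : Type*} [Finite I] [Finite O] {k : ℕ}
    (G : SepGameStructure I O) (φ : SepGR I O k) :
    -- the Büchi game for `acc` is a weak Büchi game
    G.toGS.IsWeakBuchi (φ.acc G) ∧
    -- the two games are equirealizable
    (G.toGS.Realizable φ.cond ↔ G.toGS.Realizable (GF (φ.acc G))) ∧
    -- the two games have the same winning region of the system
    G.toGS.sysRegion φ.cond = G.toGS.sysRegion (GF (φ.acc G)) ∧
    -- outside of it the environment wins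
    (∀ s, s ∉ G.toGS.sysRegion (GF (φ.acc G)) → s ∈ G.toGS.envRegion φ.cond) ∧
    -- the weak Büchi game has a memoryless strategy winning from the whole region
    (∃ fB : GState I O → BVal I → BVal O,
      ∀ s ∈ G.toGS.sysRegion (GF (φ.acc G)),
        G.toGS.SysWinsWith (GF (φ.acc G)) (memoryless fB) s) ∧
    -- for every ordering of the guarantees
    (∀ (m : ℕ) (ord : Fin m ≃ (Σ l : Fin k, Fin (φ.nGar l))),
      -- the ingredients of a travelling strategy exist
      (∃ (fr : Fin m → GState I O → BVal I → Option (BVal O))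
          (st : GState I O → BVal I → BVal O),
        (∀ j, IsReachStrategy G (φ.gar (ord j).1 (ord j).2) (fr j)) ∧ IsStayStrategy G st) ∧
      -- and the combined strategy wins the GR(k) game from the whole region
      ∀ (fB : GState I O → BVal I → BVal O)
        (fr : Fin m → GState I O → BVal I → Option (BVal O))
        (st : GState I O → BVal I → BVal O),
        (∀ s ∈ G.toGS.sysRegion (GF (φ.acc G)),
          G.toGS.SysWinsWith (GF (φ.acc G)) (memoryless fB) s) →
        (∀ j, IsReachStrategy G (φ.gar (ord j).1 (ord j).2) (fr j)) →
        IsStayStrategy G st →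
        ∀ s ∈ G.toGS.sysRegion (GF (φ.acc G)),
          G.toGS.SysWinsWith φ.cond
            (memStrategy
              (combinedStep G φ (fun j => φ.gar (ord j).1 (ord j).2) fB fr st) 0) s) := by

  obtain ⟨Z, f, g, h⟩ := G.toGS.exists_isBuchiSolution (φ.acc G)
  have hZ := h.sysRegion_eq
  have ingredients : ∀ (m : ℕ) (gar : Fin m → BVal O → Prop),
      ∃ (fr : Fin m → GState I O → BVal I → Option (BVal O)) (st : GState I O → BVal I → BVal O),
        (∀ j, IsReachStrategy G (gar j) (fr j)) ∧ IsStayStrategy G st := fun m gar => by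
    choose fr hfr using fun j => exists_isReachStrategy G (gar j)
    obtain ⟨st, hst⟩ := exists_isStayStrategy G
    exact ⟨fr, st, hfr, hst⟩
  have hordered : ∀ {m : ℕ} (ord : Fin m ≃ (Σ l : Fin k, Fin (φ.nGar l))) l j,
      ∃ t, φ.gar (ord t).1 (ord t).2 = φ.gar l j := fun ord l j =>
    ⟨ord.symm ⟨l, j⟩, by rw [Equiv.apply_symm_apply]⟩
  -- One strategy must serve all of `Z`, since realizability asks for a single strategy for all
  -- initial states.
  have hex : ∃ F, ∀ s ∈ Z, G.toGS.SysWinsWith φ.cond F s := by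
    let ord := (Finite.equivFin (Σ l : Fin k, Fin (φ.nGar l))).symm
    obtain ⟨fr, st, hfr, hst⟩ := ingredients _ fun j => φ.gar (ord j).1 (ord j).2
    exact ⟨_, fun s hs =>
      combined_sysWinsWith h (fun _ => h.sysWinsWith) (hordered ord) hfr hst hs⟩
  have hregion : G.toGS.sysRegion φ.cond = Z := by
    obtain ⟨F, hF⟩ := hex
    ext s
    refine ⟨fun ⟨F', hF'⟩ => ?_, fun hs => ⟨F, hF s hs⟩⟩
    by_contra hs
    obtain ⟨γ, hγ⟩ := exists_envWinsWith_cond h hs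
    exact GameStructure.not_sysWins_and_envWins hF' hγ
  refine ⟨isWeakBuchi_acc G φ, ⟨?_, ?_⟩, hregion.trans hZ.symm, fun s hs => ?_, ⟨f, fun s hs => ?_⟩,
    fun m ord => ⟨ingredients m _, fun fB fr st hfB hfr hst s hs => ?_⟩⟩
  · rintro ⟨init, F, hF⟩
    refine ⟨init, memoryless f, fun i hi => ⟨(hF i hi).1, h.sysWinsWith ?_⟩⟩
    rw [← hregion]
    exact ⟨F, (hF i hi).2⟩
  · rintro ⟨init, F, hF⟩
    obtain ⟨F', hF'⟩ := hex
    refine ⟨init, F', fun i hi => ⟨(hF i hi).1, hF' _ ?_⟩⟩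
    rw [← hZ]
    exact ⟨F, (hF i hi).2⟩
  · rw [hZ] at hs
    exact exists_envWinsWith_cond h hs
  · exact h.sysWinsWith (hZ ▸ hs)
  · rw [hZ] at hfB hs
    exact combined_sysWinsWith h hfB (hordered ord) hfr hst hs
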